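/- Let $\mathfrak{S}_n$ be the set of permutations $\pi=\pi(1)\cdots\pi(n)$ of $[n]=\{1,\dots,n\}$. For $\pi\in\mathfrak{S}_n$ let $\mathrm{exc}(\pi)$, $\mathrm{drop}(\pi)$, $\mathrm{fix}(\pi)$ be the numbers of $i\in[n]$ with $\pi(i)>i$, $\pi(i)<i$, $\pi(i)=i$, respectively, and let $\mathrm{cyc}(\pi)$ be the number of cycles of $\pi$ (fixed points included). Let $\mathrm{lrmin}(\pi)$ (resp. $\mathrm{rlmin}(\pi)$) be the number of $i\in[n]$ such that $\pi(i)<\pi(j)$ for all $j<i$ (resp. for all $j>i$) in $[n]$. Put $$\mathrm{asc}^*(\pi)=\#\{i\in[n-1]:\pi(i)<\pi(i+1)\},\qquad \mathrm{des}^*(\pi)=\#\{i\in[n-1]:\pi(i)>\pi(i+1)\}.$$ Let $\mathrm{pasc}(\pi)$ be the number of $i$ with $2\le i\le n$ and $\pi(i-1)<\pi(i)$ such that, for all $j\in[n]$, $\pi(j)<\pi(i)$ implies $j<i$. Let $\mathrm{pdes}(\pi)$ be the number of $i\in[n-1]$ with $\pi(i)>\pi(i+1)$ such that, for all $j\in[n]$,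 $\pi(j)<\pi(i)$ implies $j>i$. Put $\mathrm{impasc}=\mathrm{asc}^*-\mathrm{pasc}$ and $\mathrm{impdes}=\mathrm{des}^*-\mathrm{pdes}$. Let $A_n(x)=\sum_{\pi\in\mathfrak{S}_n}x^{\mathrm{des}(\pi)}$ be the Eulerian polynomial, where $\mathrm{des}(\pi)=\#\{i\in[n]:\pi(i)>\pi(i+1)\}$ with $\pi(n+1)=0$. Then for every integer $n\ge 0$ the following polynomial identities hold; that is, they hold for all elements $x,y,p,q$ of any commutative ring: $$\sum_{\pi\in\mathfrak{S}_{n+1}}x^{\mathrm{pdes}(\pi)}y^{\mathrm{pasc}(\pi)}p^{\mathrm{lrmin}(\pi)-1}q^{\mathrm{rlmin}(\pi)-1}=\sum_{\pi\in\mathfrak{S}_n}(px+qy)^{\mathrm{fix}(\pi)}(p+q)^{\mathrm{cyc}(\pi)-\mathrm{fix}(\pi)};$$ $$\sum_{\pi\in\mathfrak{S}_{n+1}}x^{\mathrm{impdes}(\pi)}y^{\mathrm{impasc}(\pi)}p^{\mathrm{lrmin}(\pi)-1}q^{\mathrm{rlmin}(\pi)-1}=\sum_{\pi\in\mathfrak{S}_n}x^{\mathrm{exc}(\pi)}y^{\mathrm{drop}(\pi)}(p+q)^{\mathrm{cyc}(\pi)};$$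 $$\sum_{\pi\in\mathfrak{S}_{n+1}}x^{\mathrm{impdes}(\pi)}y^{\mathrm{pdes}(\pi)}=\sum_{\pi\in\mathfrak{S}_n}x^{\mathrm{exc}(\pi)}(1+y)^{\mathrm{fix}(\pi)}2^{\mathrm{cyc}(\pi)-\mathrm{fix}(\pi)};$$ $$A_{n+1}(x)=x\sum_{\pi\in\mathfrak{S}_{n+1}}x^{\mathrm{impdes}(\pi)+\mathrm{pdes}(\pi)}=\sum_{\pi\in\mathfrak{S}_n}x^{\mathrm{exc}(\pi)+1}(1+x)^{\mathrm{fix}(\pi)}2^{\mathrm{cyc}(\pi)-\mathrm{fix}(\pi)}.$$ -/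

import Mathlib

namespace PermStat

/-- Permutations of `[n] = {1, …, n}` are modelled by `Equiv.Perm (Fin n)`, with `Fin n = {0, …, n-1}`
standing for `[n]` by the order isomorphism `i ↦ i + 1`. `entry π i` is the letter `π(i) ∈ [n]`
at the position `i ∈ [n]` (both counted from `1`), with the convention that it is `0` at every
other position; in particular `π(0) = π(n+1) = 0`. -/
def entry {n : ℕ} (π : Equiv.Perm (Fin n)) (i : ℕ) : ℕ :=
  if h : 1 ≤ i ∧ i ≤ n then (π ⟨i - 1, by omega⟩ : ℕ) + 1 else 0

/-- The number of descents, with the convention `π(n+1) = 0`: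
`#{i ∈ [n] : π(i) > π(i+1)}` (so the last position always counts). -/
def des {n : ℕ} (π : Equiv.Perm (Fin n)) : ℕ :=
  ((Finset.Icc 1 n).filter fun i => entry π (i + 1) < entry π i).card

/-- `asc*`: the number of interior ascents, `#{i ∈ [n-1] : π(i) < π(i+1)}`. -/
def ascStar {n : ℕ} (π : Equiv.Perm (Fin n)) : ℕ :=
  ((Finset.Ico 1 n).filter fun i => entry π i < entry π (i + 1)).card

/-- `des*`: the number of interior descents, `#{i ∈ [n-1] : π(i) > π(i+1)}`. -/
def desStar {n : ℕ} (π : Equiv.Perm (Fin n)) : ℕ :=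
  ((Finset.Ico 1 n).filter fun i => entry π (i + 1) < entry π i).card

/-- `π(i)` is a proper ascent: `2 ≤ i ≤ n`, `π(i-1) < π(i)`, and every entry smaller than `π(i)`
lies to the left of `π(i)`. -/
def IsProperAscent {n : ℕ} (π : Equiv.Perm (Fin n)) (i : ℕ) : Prop :=
  (2 ≤ i ∧ i ≤ n) ∧ entry π (i - 1) < entry π i ∧
    ∀ j ∈ Finset.Icc 1 n, entry π j < entry π i → j < i

/-- `π(i)` is a proper descent: `1 ≤ i ≤ n-1`, `π(i) > π(i+1)`, and every entry smaller than `π(i)`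
lies to the right of `π(i)`. -/
def IsProperDescent {n : ℕ} (π : Equiv.Perm (Fin n)) (i : ℕ) : Prop :=
  (1 ≤ i ∧ i < n) ∧ entry π (i + 1) < entry π i ∧
    ∀ j ∈ Finset.Icc 1 n, entry π j < entry π i → i < j

instance {n : ℕ} (π : Equiv.Perm (Fin n)) (i : ℕ) : Decidable (IsProperAscent π i) := by
  unfold IsProperAscent; infer_instance

instance {n : ℕ} (π : Equiv.Perm (Fin n)) (i : ℕ) : Decidable (IsProperDescent π i) := by
  unfold IsProperDescent; infer_instance

/-- The number of proper ascents. -/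
def pasc {n : ℕ} (π : Equiv.Perm (Fin n)) : ℕ :=
  ((Finset.Icc 1 n).filter fun i => IsProperAscent π i).card

/-- The number of proper descents. -/
def pdes {n : ℕ} (π : Equiv.Perm (Fin n)) : ℕ :=
  ((Finset.Icc 1 n).filter fun i => IsProperDescent π i).card

/-- The number of improper ascents (no truncation occurs, see `pasc_le_ascStar`). -/
def impasc {n : ℕ} (π : Equiv.Perm (Fin n)) : ℕ := ascStar π - pasc π

/-- The number of improper descents (no truncation occurs, see `pdes_le_desStar`). -/
def impdes {n : ℕ} (π : Equiv.Perm (Fin n)) : ℕ := desStar π - pdes π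

/-- The number of left-to-right minima. -/
def lrmin {n : ℕ} (π : Equiv.Perm (Fin n)) : ℕ :=
  (Finset.univ.filter fun i : Fin n => ∀ j, j < i → π i < π j).card

/-- The number of right-to-left minima. -/
def rlmin {n : ℕ} (π : Equiv.Perm (Fin n)) : ℕ :=
  (Finset.univ.filter fun i : Fin n => ∀ j, i < j → π i < π j).card

/-- The number of excedances. -/
def exc {n : ℕ} (π : Equiv.Perm (Fin n)) : ℕ :=
  (Finset.univ.filter fun i : Fin n => i < π i).card

/-- The number of drops. -/
def drop {n : ℕ} (π : Equiv.Perm (Fin n)) : ℕ :=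
  (Finset.univ.filter fun i : Fin n => π i < i).card

/-- The number of fixed points. -/
def fix {n : ℕ} (π : Equiv.Perm (Fin n)) : ℕ :=
  (Finset.univ.filter fun i : Fin n => π i = i).card

/-- The number of cycles, fixed points included: the number of parts of the partition of `n` given
by the cycle lengths of `π`. -/
def cyc {n : ℕ} (π : Equiv.Perm (Fin n)) : ℕ := Multiset.card π.partition.parts

/-- The value at `x` of the classical Eulerian polynomial `A_n(x) = ∑_{π ∈ S_n} x^{des(π)}`. -/
def eulerian {R : Type*} [CommRing R] (n : ℕ) (x : R) : R :=
  ∑ π : Equiv.Perm (Fin n), x ^ des π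

theorem pasc_le_ascStar {n : ℕ} (π : Equiv.Perm (Fin n)) : pasc π ≤ ascStar π := by
  refine Finset.card_le_card_of_injOn (fun i => i - 1) ?_ ?_
  · intro i hi
    obtain ⟨-, ⟨h2, hn⟩, h, -⟩ := Finset.mem_filter.1 hi
    refine Finset.mem_filter.2 ⟨Finset.mem_Ico.2 ⟨?_, ?_⟩, ?_⟩
    · show 1 ≤ i - 1
      omega
    · show i - 1 < n
      omega
    show entry π (i - 1) < entry π (i - 1 + 1)
    rwa [Nat.sub_add_cancel (by omega)]
  · intro i hi j hj hij
    obtain ⟨-, ⟨hi2, -⟩, -⟩ := Finset.mem_filter.1 hi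
    obtain ⟨-, ⟨hj2, -⟩, -⟩ := Finset.mem_filter.1 hj
    simp only at hij
    omega

theorem pdes_le_desStar {n : ℕ} (π : Equiv.Perm (Fin n)) : pdes π ≤ desStar π := by
  refine Finset.card_le_card fun i hi => ?_
  obtain ⟨-, h1, h, -⟩ := Finset.mem_filter.1 hi
  exact Finset.mem_filter.2 ⟨Finset.mem_Ico.2 h1, h⟩

theorem cyc_eq {n : ℕ} (π : Equiv.Perm (Fin n)) :
    cyc π = Multiset.card π.cycleType + fix π := by
  have h := Finset.card_compl π.support
  have e : π.supportᶜ = Finset.univ.filter fun i : Fin n => π i = i := by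
    ext i; simp
  rw [e] at h
  simp [cyc, fix, Equiv.Perm.partition, h]

/-- The subtraction in the exponent `cyc - fix` is not truncated. -/
theorem fix_le_cyc {n : ℕ} (π : Equiv.Perm (Fin n)) : fix π ≤ cyc π := by
  rw [cyc_eq]; omega

/-- The subtraction in the exponent `lrmin - 1` is not truncated for `n ≥ 1`. -/
theorem one_le_lrmin {n : ℕ} (π : Equiv.Perm (Fin (n + 1))) : 1 ≤ lrmin π :=
  Finset.card_pos.2 ⟨0, by simp⟩

/-- The subtraction in the exponent `rlmin - 1` is not truncated for `n ≥ 1`. -/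
theorem one_le_rlmin {n : ℕ} (π : Equiv.Perm (Fin (n + 1))) : 1 ≤ rlmin π :=
  Finset.card_pos.2 ⟨Fin.last n, by
    simp only [Finset.mem_filter, Finset.mem_univ, true_and]
    intro j hj
    exact absurd (Fin.le_last j) (not_le.2 hj)⟩

end PermStat

/-!
Weight the gaps of a word (its pairs of adjacent letters) by `u` for an improper descent, `u'` for
a proper descent, `v` for an improper ascent and `v'` for a proper ascent, every left-to-right
minimum other than the letter `1` by `p`, and every such right-to-left minimum by `q`. Inserting a
new largest letter into a gap replaces the weight of that gap by `v * u`, whatever it was; at the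
front it adds the factor `p * u'`, at the end the factor `q * v'`. So the generating functions of
words satisfy `W (n + 1) = (p * u' + q * v') * W n + D (W n)`, where `D` is the derivation sending
`u`, `u'`, `v`, `v'` to `u * v` and `p`, `q` to `0`.

Weight the arcs `i → σ i` of a permutation by `u` for an excedance, `v` for a drop and
`f = p * u' + q * v'` for a fixed point, and every longer cycle by `g = p + q`. A new element can
be a fixed point, or break an arc of a longer cycle into an excedance and a drop, which replaces
the weight of that arc by `u * v`, or extend a fixed point to a `2`-cycle, which replaces `f` by
`u * v * g = D f`. So the generating functions of permutations satisfy the same recursion.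
-/

namespace PermStat

open Equiv Finset

section Insertion

variable {n : ℕ}

/-- The word obtained from the word `π` by inserting a new largest letter at position `k`. -/
def insertMax (k : Fin (n + 1)) (π : Perm (Fin n)) : Perm (Fin (n + 1)) :=
  (finSuccEquiv' k).trans ((optionCongr π).trans (finSuccEquiv' (Fin.last n)).symm)

@[simp]
theorem insertMax_apply_self (k : Fin (n + 1)) (π : Perm (Fin n)) :
    insertMax k π k = Fin.last n := by
  simp [insertMax]

@[simp]
theorem insertMax_apply_succAbove (k : Fin (n + 1)) (π : Perm (Fin n)) (j : Fin n) :
    insertMax k π (k.succAbove j) = (π j).castSucc := by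
  simp [insertMax]

theorem insertMax_bijective (n : ℕ) :
    Function.Bijective fun a : Fin (n + 1) × Perm (Fin n) => insertMax a.1 a.2 := by
  rw [Fintype.bijective_iff_injective_and_card]
  refine ⟨?_, by simp [Fintype.card_perm, Nat.factorial_succ]⟩
  rintro ⟨k, π⟩ ⟨l, τ⟩ (h : insertMax k π = insertMax l τ)
  obtain rfl : k = l :=
    (insertMax k π).injective (by rw [insertMax_apply_self, h, insertMax_apply_self])
  refine Prod.ext rfl (Equiv.ext fun j => Fin.castSucc_injective n ?_)
  rw [← insertMax_apply_succAbove k, h, insertMax_apply_succAbove]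

theorem sum_perm_insertMax {M : Type*} [AddCommMonoid M] (f : Perm (Fin (n + 1)) → M) :
    ∑ σ, f σ = ∑ π : Perm (Fin n), ∑ k, f (insertMax k π) := by
  rw [← (insertMax_bijective n).sum_comp f, Fintype.sum_prod_type, sum_comm]

/-- The permutation obtained from `e` by adding a new smallest element as a fixed point. -/
def insertFixedPoint (e : Perm (Fin n)) : Perm (Fin (n + 1)) :=
  Perm.decomposeFin.symm (0, e)

/-- The permutation obtained from `e` by adding a new smallest element on the arc `i → e i`, which
breaks it into `i → 0 → e i`. -/
def insertOnArc (e : Perm (Fin n)) (i : Fin n) : Perm (Fin (n + 1)) :=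
  Perm.decomposeFin.symm ((e i).succ, e)

@[simp]
theorem insertFixedPoint_apply_zero (e : Perm (Fin n)) : insertFixedPoint e 0 = 0 := by
  simp [insertFixedPoint]

@[simp]
theorem insertFixedPoint_apply_succ (e : Perm (Fin n)) (j : Fin n) :
    insertFixedPoint e j.succ = (e j).succ := by
  simp [insertFixedPoint]

theorem insertOnArc_eq_swap_mul (e : Perm (Fin n)) (i : Fin n) :
    insertOnArc e i = swap 0 (e i).succ * insertFixedPoint e := by
  ext j : 1
  cases j using Fin.cases <;> simp [insertOnArc]

@[simp]
theorem insertOnArc_apply_zero (e : Perm (Fin n)) (i : Fin n) :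
    insertOnArc e i 0 = (e i).succ := by
  simp [insertOnArc]

@[simp]
theorem insertOnArc_apply_succ_self (e : Perm (Fin n)) (i : Fin n) :
    insertOnArc e i i.succ = 0 := by
  simp [insertOnArc]

theorem insertOnArc_apply_succ_of_ne (e : Perm (Fin n)) {i j : Fin n} (h : j ≠ i) :
    insertOnArc e i j.succ = (e j).succ := by
  rw [insertOnArc, Perm.decomposeFin_symm_apply_succ,
    swap_apply_of_ne_of_ne (Fin.succ_ne_zero _) (by simpa using h)]

theorem sum_perm_insertFixedPoint_add_insertOnArc {M : Type*} [AddCommMonoid M]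
    (f : Perm (Fin (n + 1)) → M) :
    ∑ σ, f σ = ∑ e : Perm (Fin n), (f (insertFixedPoint e) + ∑ i, f (insertOnArc e i)) := by
  rw [← Perm.decomposeFin.symm.sum_comp, Fintype.sum_prod_type, sum_comm]
  refine sum_congr rfl fun e _ => ?_
  rw [Fin.sum_univ_succ, ← Equiv.sum_comp e]
  rfl

end Insertion

section CycleCount

variable {α : Type*} [DecidableEq α] {σ : Perm α} {a b : α}

theorem disjoint_swap_of_apply_eq_self (ha : σ a = a) (hb : σ b = b) : (swap a b).Disjoint σ :=
  fun z => by
    by_cases hza : z = a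
    · exact Or.inr (hza ▸ ha)
    by_cases hzb : z = b
    · exact Or.inr (hzb ▸ hb)
    · exact Or.inl (swap_apply_of_ne_of_ne hza hzb)

theorem isCycle_swap_mul_of_isCycle [Finite α] (hσ : σ.IsCycle) (ha : σ a = a) (hb : σ b ≠ b) :
    (swap a b * σ).IsCycle := by
  have := Fintype.ofFinite α
  have hb_mem : b ∈ σ.support := Perm.mem_support.2 hb
  obtain ⟨l, hl⟩ : ∃ l, σ.toList b = b :: l := by
    obtain ⟨c, l, hcl⟩ := List.exists_cons_of_length_pos
      (Perm.length_toList_pos_of_mem_support σ b hb_mem)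
    have hcb := Perm.toList_getElem_zero σ b hb_mem
    simp only [hcl, List.getElem_cons_zero] at hcb
    exact ⟨l, hcb ▸ hcl⟩
  have hσl : σ = (b :: l).formPerm := by rw [← hl, Perm.formPerm_toList, hσ.cycleOf_eq hb]
  have ha_notMem : a ∉ σ.toList b := fun h =>
    hb ((Perm.mem_toList_iff.1 h).1.apply_eq_self_iff.2 ha)
  have hnodup : (a :: b :: l).Nodup :=
    hl ▸ List.nodup_cons.2 ⟨ha_notMem, Perm.nodup_toList σ b⟩
  rw [hσl, ← List.formPerm_cons_cons]
  exact List.isCycle_formPerm hnodup (by simp)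

variable [Fintype α]

theorem card_cycleType_swap_mul_of_apply_eq_self (hab : a ≠ b) (ha : σ a = a) (hb : σ b = b) :
    Multiset.card (swap a b * σ).cycleType = Multiset.card σ.cycleType + 1 := by
  rw [(disjoint_swap_of_apply_eq_self ha hb).cycleType_mul, Multiset.card_add,
    Perm.card_cycleType_eq_one.2 (Perm.isCycle_swap hab), add_comm]

theorem card_cycleType_swap_mul_of_apply_ne_self (ha : σ a = a) (hb : σ b ≠ b) :
    Multiset.card (swap a b * σ).cycleType = Multiset.card σ.cycleType := by
  set c := σ.cycleOf b with hc
  set ρ := σ * c⁻¹ with hρ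
  have hρc : ρ.Disjoint c := Perm.disjoint_mul_inv_of_mem_cycleFactorsFinset
    (Perm.cycleOf_mem_cycleFactorsFinset_iff.2 (Perm.mem_support.2 hb))
  have hσ : σ = c * ρ := by rw [← hρc.commute.eq, hρ, inv_mul_cancel_right]
  have hcycle : c.IsCycle := Perm.isCycle_cycleOf σ hb
  have hca : c a = a := by rw [hc, Perm.cycleOf_apply, ha, ite_self]
  have hcb : c b ≠ b := by rwa [hc, Perm.cycleOf_apply_self]
  have hρa : ρ a = a := by rw [hρ, Perm.mul_apply, Perm.inv_eq_iff_eq.2 hca.symm, ha]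
  have hρb : ρ b = b := (hρc b).resolve_right hcb
  have hdisj : (swap a b * c).Disjoint ρ :=
    (disjoint_swap_of_apply_eq_self hρa hρb).mul_left hρc.symm
  rw [hσ, ← mul_assoc, hdisj.cycleType_mul, hρc.symm.cycleType_mul, Multiset.card_add,
    Multiset.card_add, Perm.card_cycleType_eq_one.2 hcycle,
    Perm.card_cycleType_eq_one.2 (isCycle_swap_mul_of_isCycle hcycle hca hcb)]

theorem cycleType_insertFixedPoint {n : ℕ} (e : Perm (Fin n)) :
    (insertFixedPoint e).cycleType = e.cycleType := by
  rw [← Perm.cycleType_extendDomain (finSuccAboveEquiv (0 : Fin (n + 1))) (g := e)]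
  congr 1
  ext j : 1
  cases j using Fin.cases with
  | zero => rw [Perm.extendDomain_apply_not_subtype _ _ (by simp), insertFixedPoint_apply_zero]
  | succ j =>
    have h := Perm.extendDomain_apply_image e (finSuccAboveEquiv (0 : Fin (n + 1))) j
    simpa only [finSuccAboveEquiv_apply, Fin.succAbove_zero, insertFixedPoint_apply_succ]
      using h.symm

theorem card_cycleType_insertOnArc {n : ℕ} (e : Perm (Fin n)) (i : Fin n) :
    Multiset.card (insertOnArc e i).cycleType
      = Multiset.card e.cycleType + if e i = i then 1 else 0 := by
  have hfixed := insertFixedPoint_apply_zero e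
  rw [insertOnArc_eq_swap_mul]
  split_ifs with h
  · rw [card_cycleType_swap_mul_of_apply_eq_self (Fin.succ_ne_zero _).symm hfixed (by simp [h]),
      cycleType_insertFixedPoint]
  · rw [card_cycleType_swap_mul_of_apply_ne_self hfixed (by simpa using h),
      cycleType_insertFixedPoint, add_zero]

end CycleCount

section Derivation

variable {R A M ι : Type*} [CommSemiring R] [CommSemiring A] [AddCommMonoid M] [Algebra R A]
  [Module A M] [Module R M]

theorem derivation_prod [DecidableEq ι] (D : Derivation R A M) (s : Finset ι) (f : ι → A) :
    D (∏ i ∈ s, f i) = ∑ i ∈ s, (∏ j ∈ s.erase i, f j) • D (f i) := by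
  induction s using Finset.induction_on with
  | empty => simp
  | insert a s ha ih =>
    rw [prod_insert ha, D.leibniz, ih, sum_insert ha, erase_insert ha, add_comm, smul_sum]
    congr 1
    refine sum_congr rfl fun i hi => ?_
    rw [erase_insert_of_ne (ne_of_mem_of_not_mem hi ha).symm,
      prod_insert fun h => ha (mem_of_mem_erase h), mul_smul]

theorem derivation_mul_of_eq_zero (D : Derivation R A M) (a : A) {b : A} (hb : D b = 0) :
    D (a * b) = b • D a := by
  rw [D.leibniz, hb, smul_zero, zero_add]

end Derivation

section Words

variable {n : ℕ}

/-- The position `i` of the word `π` holds a left-to-right minimum: its letter is smaller than all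
letters on its left or, equivalently, all letters smaller than it are on its right. -/
def IsLRMin (π : Perm (Fin n)) (i : Fin n) : Prop := ∀ j, j < i → π i < π j

/-- The position `i` of the word `π` holds a right-to-left minimum: its letter is smaller than all
letters on its right or, equivalently, all letters smaller than it are on its left. -/
def IsRLMin (π : Perm (Fin n)) (i : Fin n) : Prop := ∀ j, i < j → π i < π j

instance (π : Perm (Fin n)) : DecidablePred (IsLRMin π) := fun i =>
  inferInstanceAs (Decidable (∀ j, j < i → π i < π j))

instance (π : Perm (Fin n)) : DecidablePred (IsRLMin π) := fun i =>
  inferInstanceAs (Decidable (∀ j, i < j → π i < π j))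

theorem lrmin_eq_card_isLRMin (π : Perm (Fin n)) : lrmin π = #{i | IsLRMin π i} := rfl

theorem rlmin_eq_card_isRLMin (π : Perm (Fin n)) : rlmin π = #{i | IsRLMin π i} := rfl

theorem isLRMin_iff_lt_of_apply_lt (π : Perm (Fin n)) (i : Fin n) :
    IsLRMin π i ↔ ∀ j, π j < π i → i < j := by
  refine forall_congr' fun j => ?_
  rcases eq_or_ne j i with rfl | hne
  · simp
  · have := π.injective.ne hne
    grind

theorem isRLMin_iff_lt_of_apply_lt (π : Perm (Fin n)) (i : Fin n) :
    IsRLMin π i ↔ ∀ j, π j < π i → j < i := by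
  refine forall_congr' fun j => ?_
  rcases eq_or_ne j i with rfl | hne
  · simp
  · have := π.injective.ne hne
    grind

theorem isLRMin_insertMax_self (k : Fin (n + 1)) (π : Perm (Fin n)) :
    IsLRMin (insertMax k π) k ↔ k = 0 := by
  simp only [IsLRMin, insertMax_apply_self, not_lt_of_ge (Fin.le_last _), imp_false, not_lt]
  exact ⟨fun h => Fin.le_zero_iff.1 (h 0), fun h j => h ▸ Fin.zero_le j⟩

theorem isRLMin_insertMax_self (k : Fin (n + 1)) (π : Perm (Fin n)) :
    IsRLMin (insertMax k π) k ↔ k = Fin.last n := by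
  simp only [IsRLMin, insertMax_apply_self, not_lt_of_ge (Fin.le_last _), imp_false, not_lt]
  exact ⟨fun h => Fin.last_le_iff.1 (h (Fin.last n)), fun h j => h ▸ Fin.le_last j⟩

theorem isLRMin_insertMax_succAbove (k : Fin (n + 1)) (π : Perm (Fin n)) (i : Fin n) :
    IsLRMin (insertMax k π) (k.succAbove i) ↔ IsLRMin π i := by
  simp [IsLRMin, Fin.forall_iff_succAbove k, Fin.castSucc_lt_last]

theorem isRLMin_insertMax_succAbove (k : Fin (n + 1)) (π : Perm (Fin n)) (i : Fin n) :
    IsRLMin (insertMax k π) (k.succAbove i) ↔ IsRLMin π i := by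
  simp [IsRLMin, Fin.forall_iff_succAbove k, Fin.castSucc_lt_last]

theorem lrmin_insertMax (k : Fin (n + 1)) (π : Perm (Fin n)) :
    lrmin (insertMax k π) = lrmin π + if k = 0 then 1 else 0 := by
  simp only [lrmin_eq_card_isLRMin, card_filter, Fin.sum_univ_succAbove _ k,
    isLRMin_insertMax_self, isLRMin_insertMax_succAbove, add_comm]

theorem rlmin_insertMax (k : Fin (n + 1)) (π : Perm (Fin n)) :
    rlmin (insertMax k π) = rlmin π + if k = Fin.last n then 1 else 0 := by
  simp only [rlmin_eq_card_isRLMin, card_filter, Fin.sum_univ_succAbove _ k,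
    isRLMin_insertMax_self, isRLMin_insertMax_succAbove, add_comm]

section Weight

variable {A : Type*} (u u' v v' : A) (π : Perm (Fin (n + 1)))

/-- The weight of the gap between the letters at the positions `i` and `i + 1` of the word `π`:
`u` for an improper descent, `u'` for a proper descent, `v` for an improper ascent, `v'` for a
proper ascent. A descent is proper if its larger letter is a left-to-right minimum, an ascent is
proper if its larger letter is a right-to-left minimum. -/
def gapWeight (i : Fin n) : A :=
  if π i.succ < π i.castSucc then
    if IsLRMin π i.castSucc then u' else u
  else
    if IsRLMin π i.succ then v' else v

theorem gapWeight_insertMax_of_eq_succAbove {k : Fin (n + 2)} {i : Fin n} {j : Fin (n + 1)}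
    (hleft : j.castSucc = k.succAbove i.castSucc) (hright : j.succ = k.succAbove i.succ) :
    gapWeight u u' v v' (insertMax k π) j = gapWeight u u' v v' π i := by
  simp only [gapWeight, hleft, hright, insertMax_apply_succAbove, Fin.castSucc_lt_castSucc_iff,
    isLRMin_insertMax_succAbove, isRLMin_insertMax_succAbove]

theorem gapWeight_insertMax_castSucc (j : Fin (n + 1)) :
    gapWeight u u' v v' (insertMax j.castSucc π) j = if j = 0 then u' else u := by
  have hright : insertMax j.castSucc π j.succ < Fin.last (n + 1) := by
    rw [← Fin.succAbove_castSucc_self, insertMax_apply_succAbove]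
    exact Fin.castSucc_lt_last _
  simp only [gapWeight, insertMax_apply_self, hright, isLRMin_insertMax_self, if_true,
    Fin.castSucc_eq_zero_iff]

theorem gapWeight_insertMax_succ (j : Fin (n + 1)) :
    gapWeight u u' v v' (insertMax j.succ π) j = if j = Fin.last n then v' else v := by
  simp only [gapWeight, insertMax_apply_self, not_lt_of_ge (Fin.le_last _),
    isRLMin_insertMax_self, if_false, Fin.succ_eq_last_succ]

end Weight

section WordWeight

variable {A : Type*} [CommSemiring A] (u u' v v' p q : A) (π : Perm (Fin (n + 1)))

theorem prod_gapWeight_insertMax_zero :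
    ∏ j, gapWeight u u' v v' (insertMax 0 π) j = u' * ∏ i, gapWeight u u' v v' π i := by
  rw [Fin.prod_univ_succ, ← Fin.castSucc_zero, gapWeight_insertMax_castSucc, if_pos rfl]
  congr 1
  exact prod_congr rfl fun i _ =>
    gapWeight_insertMax_of_eq_succAbove _ _ _ _ _ (by simp) (by simp)

theorem prod_gapWeight_insertMax_last :
    ∏ j, gapWeight u u' v v' (insertMax (Fin.last (n + 1)) π) j
      = v' * ∏ i, gapWeight u u' v v' π i := by
  rw [Fin.prod_univ_castSucc, mul_comm, ← Fin.succ_last, gapWeight_insertMax_succ, if_pos rfl]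
  congr 1
  exact prod_congr rfl fun i _ =>
    gapWeight_insertMax_of_eq_succAbove _ _ _ _ _ (by simp) (by simp)

theorem prod_gapWeight_insertMax_gap (i : Fin n) :
    ∏ j, gapWeight u u' v v' (insertMax i.succ.castSucc π) j
      = (∏ j ∈ univ.erase i, gapWeight u u' v v' π j) * (u * v) := by
  have hbefore : gapWeight u u' v v' (insertMax i.succ.castSucc π) i.castSucc = v := by
    rw [← Fin.succ_castSucc, gapWeight_insertMax_succ, if_neg (Fin.castSucc_lt_last i).ne]
  have hafter : gapWeight u u' v v' (insertMax i.succ.castSucc π) i.succ = u := by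
    rw [gapWeight_insertMax_castSucc, if_neg (Fin.succ_ne_zero i)]
  have hother (j : Fin n) (hj : j ∈ univ.erase i) :
      gapWeight u u' v v' (insertMax i.succ.castSucc π) (i.castSucc.succAbove j)
        = gapWeight u u' v v' π j := by
    refine gapWeight_insertMax_of_eq_succAbove _ _ _ _ _ ?_ ?_
    · rw [Fin.castSucc_succAbove_castSucc, Fin.castSucc_inj]
      rcases (ne_of_mem_erase hj).lt_or_gt with h | h
      · rw [Fin.succAbove_castSucc_of_lt _ _ h, Fin.succAbove_succ_of_le _ _ h.le]
      · rw [Fin.succAbove_castSucc_of_le _ _ h.le, Fin.succAbove_succ_of_lt _ _ h]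
    · rw [← Fin.succ_castSucc, Fin.succ_succAbove_succ]
  rw [Fin.prod_univ_succAbove _ i.castSucc, ← mul_prod_erase univ _ (mem_univ i),
    Fin.succAbove_castSucc_self, hbefore, hafter, prod_congr rfl hother, ← mul_assoc, mul_comm v,
    mul_comm]

/-- The weight of a word: the product of its gap weights, with a factor `p` for every left-to-right
minimum and a factor `q` for every right-to-left minimum other than the smallest letter, which is
always both. -/
def wordWeight : A :=
  (∏ i, gapWeight u u' v v' π i) * (p ^ (lrmin π - 1) * q ^ (rlmin π - 1))

theorem wordWeight_insertMax_zero :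
    wordWeight u u' v v' p q (insertMax 0 π) = p * u' * wordWeight u u' v v' p q π := by
  obtain ⟨l, hl⟩ := Nat.exists_eq_add_of_le' (one_le_lrmin π)
  simp only [wordWeight, prod_gapWeight_insertMax_zero, lrmin_insertMax, rlmin_insertMax, if_true,
    if_neg (Fin.last_pos' (n := n + 1)).ne, hl, add_zero, Nat.add_sub_cancel, pow_succ]
  ring

theorem wordWeight_insertMax_last :
    wordWeight u u' v v' p q (insertMax (Fin.last (n + 1)) π)
      = q * v' * wordWeight u u' v v' p q π := by
  obtain ⟨r, hr⟩ := Nat.exists_eq_add_of_le' (one_le_rlmin π)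
  simp only [wordWeight, prod_gapWeight_insertMax_last, lrmin_insertMax, rlmin_insertMax, if_true,
    if_neg (Fin.last_pos' (n := n + 1)).ne', hr, add_zero, Nat.add_sub_cancel, pow_succ]
  ring

variable {u u' v v' p q} {R : Type*} [CommSemiring R] [Algebra R A] {D : Derivation R A A}

theorem derivation_wordWeight (hu : D u = u * v) (hu' : D u' = u * v) (hv : D v = u * v)
    (hv' : D v' = u * v) (hp : D p = 0) (hq : D q = 0) :
    D (wordWeight u u' v v' p q π)
      = ∑ i : Fin n, wordWeight u u' v v' p q (insertMax i.succ.castSucc π) := by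
  have hgap (i : Fin n) : D (gapWeight u u' v v' π i) = u * v := by
    unfold gapWeight
    split_ifs <;> assumption
  have hpq : D (p ^ (lrmin π - 1) * q ^ (rlmin π - 1)) = 0 := by
    simp [D.leibniz, D.leibniz_pow, hp, hq]
  rw [wordWeight, derivation_mul_of_eq_zero D _ hpq, derivation_prod, smul_eq_mul, mul_comm,
    sum_mul]
  refine sum_congr rfl fun i _ => ?_
  have hlr : i.succ.castSucc ≠ 0 := Fin.castSucc_ne_zero_of_lt (Fin.succ_pos i)
  rw [wordWeight, prod_gapWeight_insertMax_gap, lrmin_insertMax, rlmin_insertMax, if_neg hlr,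
    if_neg (Fin.castSucc_lt_last _).ne, add_zero, add_zero, hgap, smul_eq_mul]

theorem sum_wordWeight_succ (hu : D u = u * v) (hu' : D u' = u * v) (hv : D v = u * v)
    (hv' : D v' = u * v) (hp : D p = 0) (hq : D q = 0) :
    ∑ σ : Perm (Fin (n + 2)), wordWeight u u' v v' p q σ
      = (p * u' + q * v') * (∑ π : Perm (Fin (n + 1)), wordWeight u u' v v' p q π)
        + D (∑ π : Perm (Fin (n + 1)), wordWeight u u' v v' p q π) := by
  rw [sum_perm_insertMax, map_sum, mul_sum, ← sum_add_distrib]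
  refine sum_congr rfl fun π _ => ?_
  rw [Fin.sum_univ_castSucc, Fin.sum_univ_succ, Fin.castSucc_zero, wordWeight_insertMax_zero,
    wordWeight_insertMax_last, derivation_wordWeight π hu hu' hv hv' hp hq]
  ring

end WordWeight

end Words

section Cycles

variable {n : ℕ} {A : Type*} [CommSemiring A] (u v f g : A)

/-- The weight of the arc `i → σ i`: `u` for an excedance, `v` for a drop, `f` for a fixed point. -/
def arcWeight (σ : Perm (Fin n)) (i : Fin n) : A :=
  if i < σ i then u else if σ i < i then v else f

theorem prod_arcWeight (σ : Perm (Fin n)) :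
    ∏ i, arcWeight u v f σ i = u ^ exc σ * v ^ drop σ * f ^ fix σ := by
  have hsplit (i : Fin n) : arcWeight u v f σ i = (if i < σ i then u else 1) *
      (if σ i < i then v else 1) * (if σ i = i then f else 1) := by
    unfold arcWeight
    rcases lt_trichotomy i (σ i) with h | h | h
    · simp [h, h.not_gt, h.ne']
    · simp [← h]
    · simp [h, h.not_gt, h.ne]
  simp only [hsplit, prod_mul_distrib, prod_ite, prod_const, one_pow, mul_one, exc, drop, fix]

theorem prod_arcWeight_insertFixedPoint (e : Perm (Fin n)) :
    ∏ j, arcWeight u v f (insertFixedPoint e) j = (∏ i, arcWeight u v f e i) * f := by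
  rw [Fin.prod_univ_succ, mul_comm]
  simp [arcWeight]

theorem prod_arcWeight_insertOnArc (e : Perm (Fin n)) (i : Fin n) :
    ∏ j, arcWeight u v f (insertOnArc e i) j
      = (∏ j ∈ univ.erase i, arcWeight u v f e j) * (u * v) := by
  have hzero : arcWeight u v f (insertOnArc e i) 0 = u := by simp [arcWeight]
  have hself : arcWeight u v f (insertOnArc e i) i.succ = v := by simp [arcWeight]
  have hother (j : Fin n) (hj : j ∈ univ.erase i) :
      arcWeight u v f (insertOnArc e i) j.succ = arcWeight u v f e j := by
    simp [arcWeight, insertOnArc_apply_succ_of_ne e (ne_of_mem_erase hj)]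
  rw [Fin.prod_univ_succ, ← mul_prod_erase univ _ (mem_univ i), hzero, hself,
    prod_congr rfl hother, ← mul_assoc, mul_comm]

/-- The weight of a permutation: the product of its arc weights, with a factor `g` for every cycle
that is not a fixed point. -/
def cycleWeight (σ : Perm (Fin n)) : A :=
  (∏ i, arcWeight u v f σ i) * g ^ Multiset.card σ.cycleType

variable {u v f g} {R : Type*} [CommSemiring R] [Algebra R A] {D : Derivation R A A}

theorem derivation_cycleWeight (hu : D u = u * v) (hv : D v = u * v) (hf : D f = u * v * g)
    (hg : D g = 0) (e : Perm (Fin n)) :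
    D (cycleWeight u v f g e) = ∑ i, cycleWeight u v f g (insertOnArc e i) := by
  have harc (i : Fin n) :
      D (arcWeight u v f e i) = u * v * g ^ (if e i = i then 1 else 0) := by
    unfold arcWeight
    rcases lt_trichotomy i (e i) with h | h | h
    · simp [h, h.ne', hu]
    · simp [← h, hf]
    · simp [h, h.not_gt, h.ne, hv]
  have hpow : D (g ^ Multiset.card e.cycleType) = 0 := by simp [D.leibniz_pow, hg]
  rw [cycleWeight, derivation_mul_of_eq_zero D _ hpow, derivation_prod, smul_eq_mul, mul_sum]
  refine sum_congr rfl fun i _ => ?_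
  rw [cycleWeight, prod_arcWeight_insertOnArc, card_cycleType_insertOnArc, harc, pow_add,
    smul_eq_mul]
  ring

theorem sum_cycleWeight_succ (hu : D u = u * v) (hv : D v = u * v) (hf : D f = u * v * g)
    (hg : D g = 0) :
    ∑ σ : Perm (Fin (n + 1)), cycleWeight u v f g σ
      = f * (∑ e : Perm (Fin n), cycleWeight u v f g e)
        + D (∑ e : Perm (Fin n), cycleWeight u v f g e) := by
  rw [sum_perm_insertFixedPoint_add_insertOnArc, map_sum, mul_sum, ← sum_add_distrib]
  refine sum_congr rfl fun e _ => ?_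
  rw [derivation_cycleWeight hu hv hf hg, cycleWeight, cycleWeight,
    prod_arcWeight_insertFixedPoint, cycleType_insertFixedPoint, mul_right_comm, mul_comm]

end Cycles

section Comparison

variable {A B : Type*} [CommSemiring A] [CommSemiring B]

theorem sum_wordWeight_eq_sum_cycleWeight_of_derivation {R : Type*} [CommSemiring R] [Algebra R A]
    {D : Derivation R A A} {u u' v v' p q : A} (hu : D u = u * v) (hu' : D u' = u * v)
    (hv : D v = u * v) (hv' : D v' = u * v) (hp : D p = 0) (hq : D q = 0) (n : ℕ) :
    ∑ π : Perm (Fin (n + 1)), wordWeight u u' v v' p q π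
      = ∑ σ : Perm (Fin n), cycleWeight u v (p * u' + q * v') (p + q) σ := by
  have hf : D (p * u' + q * v') = u * v * (p + q) := by
    simp only [map_add, D.leibniz, hp, hq, hu', hv', smul_eq_mul]
    ring
  have hg : D (p + q) = 0 := by rw [map_add, hp, hq, add_zero]
  induction n with
  | zero => simp [wordWeight, cycleWeight, lrmin, rlmin]
  | succ n ih =>
    rw [sum_wordWeight_succ hu hu' hv hv' hp hq, sum_cycleWeight_succ hu hv hf hg, ih]

variable {F : Type*} [FunLike F A B] [RingHomClass F A B] {n : ℕ}

theorem map_wordWeight (φ : F) (u u' v v' p q : A) (π : Perm (Fin (n + 1))) :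
    φ (wordWeight u u' v v' p q π) = wordWeight (φ u) (φ u') (φ v) (φ v') (φ p) (φ q) π := by
  simp only [wordWeight, gapWeight, map_mul, map_pow, map_prod, apply_ite φ]

theorem map_cycleWeight (φ : F) (u v f g : A) (σ : Perm (Fin n)) :
    φ (cycleWeight u v f g σ) = cycleWeight (φ u) (φ v) (φ f) (φ g) σ := by
  simp only [cycleWeight, arcWeight, map_mul, map_pow, map_prod, apply_ite φ]

theorem sum_wordWeight_eq_sum_cycleWeight (u u' v v' p q : A) :
    ∑ π : Perm (Fin (n + 1)), wordWeight u u' v v' p q π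
      = ∑ σ : Perm (Fin n), cycleWeight u v (p * u' + q * v') (p + q) σ := by
  -- For independent variables a derivation with the required values exists; then specialize.
  let X : Fin 6 → MvPolynomial (Fin 6) ℕ := MvPolynomial.X
  let D := MvPolynomial.mkDerivation ℕ ![X 0 * X 2, X 0 * X 2, X 0 * X 2, X 0 * X 2, 0, 0]
  let φ : MvPolynomial (Fin 6) ℕ →ₐ[ℕ] A := MvPolynomial.aeval ![u, u', v, v', p, q]
  have hD := MvPolynomial.mkDerivation_X ℕ ![X 0 * X 2, X 0 * X 2, X 0 * X 2, X 0 * X 2, 0, 0]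
  have hφ (i : Fin 6) : φ (X i) = ![u, u', v, v', p, q] i := MvPolynomial.aeval_X _ i
  have h := congrArg φ <| sum_wordWeight_eq_sum_cycleWeight_of_derivation (D := D)
    (hD 0) (hD 1) (hD 2) (hD 3) (hD 4) (hD 5) n
  simpa [X, map_wordWeight, map_cycleWeight, hφ] using h

end Comparison

section Statistics

variable {n : ℕ}

theorem entry_val_add_one (π : Perm (Fin n)) (i : Fin n) : entry π (i + 1) = π i + 1 := by
  simp [entry]

theorem forall_mem_Icc_one_iff {P : ℕ → Prop} :
    (∀ j ∈ Icc 1 n, P j) ↔ ∀ j : Fin n, P (j + 1) := by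
  refine ⟨fun h j => h _ (mem_Icc.2 ⟨by omega, by omega⟩), fun h j hj => ?_⟩
  obtain ⟨h_one_le, h_le⟩ := mem_Icc.1 hj
  simpa only [Nat.sub_add_cancel h_one_le] using h ⟨j - 1, by omega⟩

theorem card_filter_Icc_one (P : ℕ → Prop) [DecidablePred P] :
    #{i ∈ Icc 1 n | P i} = #{i : Fin n | P (i + 1)} := by
  simp only [card_filter, ← Ico_add_one_right_eq_Icc, sum_Ico_eq_sum_range, sum_range,
    Nat.add_sub_cancel, add_comm 1]

variable (π : Perm (Fin (n + 1)))

theorem entry_add_one (i : Fin n) : entry π (i + 1) = π i.castSucc + 1 :=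
  entry_val_add_one π i.castSucc

theorem entry_add_two (i : Fin n) : entry π (i + 1 + 1) = π i.succ + 1 :=
  entry_val_add_one π i.succ

theorem desStar_eq_card : desStar π = #{i : Fin n | π i.succ < π i.castSucc} := by
  rw [desStar, Ico_add_one_right_eq_Icc, card_filter_Icc_one]
  simp only [entry_add_one, entry_add_two, add_lt_add_iff_right, Fin.lt_def]

theorem ascStar_eq_card : ascStar π = #{i : Fin n | ¬ π i.succ < π i.castSucc} := by
  have hne (i : Fin n) : π i.castSucc ≠ π i.succ := π.injective.ne i.castSucc_lt_succ.ne
  rw [ascStar, Ico_add_one_right_eq_Icc, card_filter_Icc_one]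
  simp only [entry_add_one, entry_add_two, add_lt_add_iff_right, ← Fin.lt_def, not_lt,
    (hne _).le_iff_lt]

theorem isProperDescent_iff (i : Fin n) :
    IsProperDescent π (i + 1) ↔ π i.succ < π i.castSucc ∧ IsLRMin π i.castSucc := by
  rw [IsProperDescent, forall_mem_Icc_one_iff, isLRMin_iff_lt_of_apply_lt]
  simp [entry_add_one, entry_add_two, entry_val_add_one, Fin.lt_def, -Fin.val_fin_lt]

theorem isProperAscent_iff (i : Fin n) :
    IsProperAscent π (i + 1 + 1) ↔ ¬ π i.succ < π i.castSucc ∧ IsRLMin π i.succ := by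
  have hne : π i.castSucc ≠ π i.succ := π.injective.ne i.castSucc_lt_succ.ne
  rw [IsProperAscent, forall_mem_Icc_one_iff, isRLMin_iff_lt_of_apply_lt]
  simp [entry_add_one, entry_add_two, entry_val_add_one, hne.le_iff_lt, Fin.lt_def,
    -Fin.val_fin_lt]

theorem pdes_eq_card :
    pdes π = #{i : Fin n | π i.succ < π i.castSucc ∧ IsLRMin π i.castSucc} := by
  have hlast : ¬ IsProperDescent π (n + 1) := fun h => h.1.2.false
  rw [pdes, card_filter_Icc_one]
  simp only [card_filter, Fin.sum_univ_castSucc, Fin.val_castSucc, Fin.val_last,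
    isProperDescent_iff, if_neg hlast, add_zero]

theorem pasc_eq_card :
    pasc π = #{i : Fin n | ¬ π i.succ < π i.castSucc ∧ IsRLMin π i.succ} := by
  have hfirst : ¬ IsProperAscent π (0 + 1) := fun h => absurd h.1.1 (by decide)
  rw [pasc, card_filter_Icc_one]
  simp only [card_filter, Fin.sum_univ_succ, Fin.val_succ, Fin.val_zero,
    isProperAscent_iff, if_neg hfirst, zero_add]

theorem impdes_eq_card :
    impdes π = #{i : Fin n | π i.succ < π i.castSucc ∧ ¬ IsLRMin π i.castSucc} := by
  rw [impdes, desStar_eq_card, pdes_eq_card, ← filter_filter, ← filter_filter,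
    ← card_filter_add_card_filter_not fun i : Fin n => IsLRMin π i.castSucc,
    Nat.add_sub_cancel_left]

theorem impasc_eq_card :
    impasc π = #{i : Fin n | ¬ π i.succ < π i.castSucc ∧ ¬ IsRLMin π i.succ} := by
  rw [impasc, ascStar_eq_card, pasc_eq_card, ← filter_filter, ← filter_filter,
    ← card_filter_add_card_filter_not fun i : Fin n => IsRLMin π i.succ,
    Nat.add_sub_cancel_left]

theorem des_eq_desStar_add_one : des π = desStar π + 1 := by
  have hlast : entry π (n + 1 + 1) < entry π (n + 1) := by simp [entry]
  rw [des, desStar, ← Ico_insert_right (Nat.le_add_left 1 n), filter_insert, if_pos hlast,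
    card_insert_of_notMem (by simp)]

theorem des_eq_impdes_add_pdes_add_one : des π = impdes π + pdes π + 1 := by
  rw [des_eq_desStar_add_one, impdes, Nat.sub_add_cancel (pdes_le_desStar π)]

variable {A : Type*} [CommSemiring A] (u u' v v' p q : A)

theorem prod_gapWeight :
    ∏ i, gapWeight u u' v v' π i
      = u ^ impdes π * u' ^ pdes π * (v ^ impasc π * v' ^ pasc π) := by
  simp only [gapWeight, prod_ite, prod_const, filter_filter, impdes_eq_card, pdes_eq_card,
    impasc_eq_card, pasc_eq_card]
  ring

theorem sum_word_statistics_eq_sum_cycle_statistics :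
    ∑ π : Perm (Fin (n + 1)), u ^ impdes π * u' ^ pdes π * (v ^ impasc π * v' ^ pasc π) *
        (p ^ (lrmin π - 1) * q ^ (rlmin π - 1))
      = ∑ σ : Perm (Fin n), u ^ exc σ * v ^ drop σ * (p * u' + q * v') ^ fix σ *
          (p + q) ^ (cyc σ - fix σ) := by
  have h := sum_wordWeight_eq_sum_cycleWeight (n := n) u u' v v' p q
  simpa only [wordWeight, prod_gapWeight, cycleWeight, prod_arcWeight, cyc_eq,
    Nat.add_sub_cancel] using h

end Statistics

end PermStat

theorem mainTheorem8_general {R : Type*} [CommSemiring R] (n : ℕ) (x y p q : R) :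
    (∑ π : Equiv.Perm (Fin (n + 1)),
        x ^ PermStat.pdes π * y ^ PermStat.pasc π *
          p ^ (PermStat.lrmin π - 1) * q ^ (PermStat.rlmin π - 1)
      = ∑ π : Equiv.Perm (Fin n),
          (p * x + q * y) ^ PermStat.fix π * (p + q) ^ (PermStat.cyc π - PermStat.fix π)) ∧
    (∑ π : Equiv.Perm (Fin (n + 1)),
        x ^ PermStat.impdes π * y ^ PermStat.impasc π *
          p ^ (PermStat.lrmin π - 1) * q ^ (PermStat.rlmin π - 1)
      = ∑ π : Equiv.Perm (Fin n),
          x ^ PermStat.exc π * y ^ PermStat.drop π * (p + q) ^ PermStat.cyc π) ∧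
    (∑ π : Equiv.Perm (Fin (n + 1)), x ^ PermStat.impdes π * y ^ PermStat.pdes π
      = ∑ π : Equiv.Perm (Fin n),
          x ^ PermStat.exc π * (1 + y) ^ PermStat.fix π *
            2 ^ (PermStat.cyc π - PermStat.fix π)) ∧
    (∑ π : Equiv.Perm (Fin (n + 1)), x ^ PermStat.des π
      = x * ∑ π : Equiv.Perm (Fin (n + 1)), x ^ (PermStat.impdes π + PermStat.pdes π)) ∧
    (∑ π : Equiv.Perm (Fin (n + 1)), x ^ PermStat.des π
      = ∑ π : Equiv.Perm (Fin n),
          x ^ (PermStat.exc π + 1) * (1 + x) ^ PermStat.fix π *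
            2 ^ (PermStat.cyc π - PermStat.fix π)) := by
  have master := PermStat.sum_word_statistics_eq_sum_cycle_statistics (n := n) (A := R)
  have impdes_pdes (x y : R) :
      ∑ π : Equiv.Perm (Fin (n + 1)), x ^ PermStat.impdes π * y ^ PermStat.pdes π
        = ∑ π : Equiv.Perm (Fin n), x ^ PermStat.exc π * (1 + y) ^ PermStat.fix π *
            2 ^ (PermStat.cyc π - PermStat.fix π) := by
    simpa [add_comm, one_add_one_eq_two] using master x y 1 1 1 1
  have des : ∑ π : Equiv.Perm (Fin (n + 1)), x ^ PermStat.des π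
      = x * ∑ π : Equiv.Perm (Fin (n + 1)), x ^ (PermStat.impdes π + PermStat.pdes π) := by
    simp only [PermStat.des_eq_impdes_add_pdes_add_one, pow_succ', Finset.mul_sum]
  refine ⟨?_, ?_, impdes_pdes x y, des, ?_⟩
  · simpa [mul_assoc] using master 1 x 1 y p q
  · have cyc (π : Equiv.Perm (Fin n)) : (p + q) ^ PermStat.cyc π
        = (p + q) ^ PermStat.fix π * (p + q) ^ (PermStat.cyc π - PermStat.fix π) := by
      rw [← pow_add, Nat.add_sub_cancel' (PermStat.fix_le_cyc π)]
    simpa [cyc, mul_assoc] using master x 1 y 1 p q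
  · simp only [des, pow_add, impdes_pdes x x, Finset.mul_sum, pow_one]
    exact Finset.sum_congr rfl fun π _ => by ring

theorem mainTheorem8 {R : Type*} [CommRing R] (n : ℕ) (x y p q : R) :
    (∑ π : Equiv.Perm (Fin (n + 1)),
        x ^ PermStat.pdes π * y ^ PermStat.pasc π *
          p ^ (PermStat.lrmin π - 1) * q ^ (PermStat.rlmin π - 1)
      = ∑ π : Equiv.Perm (Fin n),
          (p * x + q * y) ^ PermStat.fix π * (p + q) ^ (PermStat.cyc π - PermStat.fix π)) ∧
    (∑ π : Equiv.Perm (Fin (n + 1)),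
        x ^ PermStat.impdes π * y ^ PermStat.impasc π *
          p ^ (PermStat.lrmin π - 1) * q ^ (PermStat.rlmin π - 1)
      = ∑ π : Equiv.Perm (Fin n),
          x ^ PermStat.exc π * y ^ PermStat.drop π * (p + q) ^ PermStat.cyc π) ∧
    (∑ π : Equiv.Perm (Fin (n + 1)), x ^ PermStat.impdes π * y ^ PermStat.pdes π
      = ∑ π : Equiv.Perm (Fin n),
          x ^ PermStat.exc π * (1 + y) ^ PermStat.fix π *
            2 ^ (PermStat.cyc π - PermStat.fix π)) ∧
    (PermStat.eulerian (n + 1) x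
      = x * ∑ π : Equiv.Perm (Fin (n + 1)), x ^ (PermStat.impdes π + PermStat.pdes π)) ∧
    (PermStat.eulerian (n + 1) x
      = ∑ π : Equiv.Perm (Fin n),
          x ^ (PermStat.exc π + 1) * (1 + x) ^ PermStat.fix π *
            2 ^ (PermStat.cyc π - PermStat.fix π)) :=
  mainTheorem8_general n x y p q
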